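/- For $k\in\mathbb{C}$ define $$\varphi(k)=1-k+\frac{\pi}{2}\int_{0}^{\infty}\operatorname{csch}^2\!\Big(\frac{\pi u}{2}\Big)\Big(1-(1+u^2)^{k/2}\cos(k\arctan u)\Big)\,du .$$ The trivial zeros of $\zeta$ are the negative even integers. Call the positive odd integers and the points $1+2\pi i j/\log 2$ ($j\in\mathbb{Z}$) the trivial zeros of $\varphi$. A zero of $\zeta$, respectively of $\varphi$, that is not trivial is called non-trivial. Write $k!=\Gamma(k+1)$. Theorem. The integral converges absolutely for every $k\in\mathbb{C}$, and $\varphi$ is an entire function. Moreover: 1. For every $k\in\mathbb{C}$ other than $1$ and the negative integers, $$-2\,k!\,\big(2^{1-k}-1\big)\,\pi^{-k}\cos\!\Big(\frac{\pi k}{2}\Big)\,\zeta(k)=\varphi(k).$$ 2. For every $k\in\mathbb{C}\setminus\{1\}$, $$2(k-1)\big(1-2^{-k}\big)\zeta(k)=\varphi(1-k).$$ 3. The trivial zeros of $\varphi$ are indeed zeros of $\varphi$. A complex number $k$ is a non-trivial zero of $\zeta$ if and only if it is a non-trivial zero of $\varphi$. The non-trivial zeros of $\varphi$ are exactly the zeros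 of $\varphi$ with $0<\Re(k)<1$. 4. The Riemann hypothesis holds if and only if every zero $k$ of $\varphi$ with $0<\Re(k)<1$ satisfies $\Re(k)=\tfrac12$. -/

import Mathlib

noncomputable section

/-- The integrand in the definition of `varphi`, at a complex parameter `k` and a real `u > 0`;
`csch x` is written `(sinh x)⁻¹`, and the power is that of the positive real base `1 + u ^ 2`. -/
def varphiIntegrand (k : ℂ) (u : ℝ) : ℂ :=
  (((Real.sinh (Real.pi * u / 2))⁻¹ ^ 2 : ℝ) : ℂ) *
    (1 - ((1 + u ^ 2 : ℝ) : ℂ) ^ (k / 2) * Complex.cos (k * (Real.arctan u : ℂ)))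

/-- `φ(k) = 1 - k + (π / 2) ∫₀^∞ csch²(π u / 2) (1 - (1 + u²)^(k/2) cos (k arctan u)) du`. -/
def varphi (k : ℂ) : ℂ :=
  1 - k + (Real.pi / 2 : ℂ) * ∫ u in Set.Ioi (0 : ℝ), varphiIntegrand k u

/-- Non-trivial zeros of the Riemann zeta function: the zeros that are not negative even integers.
The pole `1`, where Mathlib's `riemannZeta` takes a conventional value, is not a zero. -/
def IsNontrivialZetaZero (k : ℂ) : Prop :=
  k ≠ 1 ∧ riemannZeta k = 0 ∧ ¬ ∃ n : ℕ, k = -2 * ((n : ℂ) + 1)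

/-- Trivial zeros of `φ`: the positive odd integers, and the points `1 + 2 π i j / log 2`
for integer `j`. -/
def IsTrivialVarphiPoint (k : ℂ) : Prop :=
  (∃ n : ℕ, k = 2 * (n : ℂ) + 1) ∨
    ∃ j : ℤ, k = 1 + 2 * (Real.pi : ℂ) * Complex.I * (j : ℂ) / ((Real.log 2 : ℝ) : ℂ)

/-- Non-trivial zeros of `φ`: its zeros other than the trivial ones. -/
def IsNontrivialVarphiZero (k : ℂ) : Prop :=
  varphi k = 0 ∧ ¬ IsTrivialVarphiPoint k

end

/-!
For `0 < Re a` the product `Γ(a) φ(-a)` is the Mellin transform of `t / sinh t` at `a`. Indeed,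
`Γ(a)` times the integrand of `φ(-a)` is the Mellin transform in `t` of
`csch²(π u / 2) e^{-t} (1 - cos (u t))`, the integral of the latter over `u > 0` is
`(2 / π) e^{-t} (t coth t - 1)`, and `e^{-t} (t coth t - 1) + e^{-t} + t e^{-t} = t / sinh t`.
Expanding `1 / sinh t` in powers of `e^{-t}` evaluates the same transform as
`2 Γ(a + 1) (1 - 2^{-a-1}) ζ(a + 1)`. The resulting formula for `φ(1 - k)` extends to all `k ≠ 1` by
the identity theorem and turns into the formula for `φ(k)` by the functional equation of `ζ`. The
zeros of `φ` are then read off `φ(k) = -2 k (1 - 2^{k-1}) ζ(1 - k)`.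
-/

open Complex MeasureTheory Filter Topology Set

/-! ### Holomorphic dependence on a parameter -/

section HolomorphicIntegral

variable {α E : Type*} [MeasurableSpace α] {μ : Measure α} [NormedAddCommGroup E]

theorem aestronglyMeasurable_deriv_of_eventually {𝕜 : Type*} [NontriviallyNormedField 𝕜]
    [NormedSpace 𝕜 E] {F : 𝕜 → α → E} {z₀ : 𝕜}
    (hF : ∀ᶠ z in 𝓝 z₀, AEStronglyMeasurable (F z) μ)
    (hd : ∀ᵐ a ∂μ, DifferentiableAt 𝕜 (F · a) z₀) :
    AEStronglyMeasurable (fun a ↦ deriv (F · a) z₀) μ := by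
  have hF_punctured : ∃ᶠ z in 𝓝[≠] z₀, AEStronglyMeasurable (F z) μ :=
    (hF.filter_mono nhdsWithin_le_nhds).frequently
  obtain ⟨v, hv, hFv⟩ := exists_seq_forall_of_frequently hF_punctured
  refine aestronglyMeasurable_of_tendsto_ae atTop
    (f := fun n a ↦ slope (F · a) z₀ (v n)) (fun n ↦ ?_) ?_
  · simp only [slope_def_module]
    exact ((hFv n).sub hF.self_of_nhds).const_smul (_ : 𝕜)
  · filter_upwards [hd] with a ha
    exact (hasDerivAt_iff_tendsto_slope.1 ha.hasDerivAt).comp hv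

theorem differentiableAt_integral_of_dominated [NormedSpace ℂ E] {F : ℂ → α → E} {z₀ : ℂ}
    {s : Set ℂ} {bound : α → ℝ} (hs : s ∈ 𝓝 z₀)
    (hF_meas : ∀ᶠ z in 𝓝 z₀, AEStronglyMeasurable (F z) μ)
    (h_diff : ∀ᵐ a ∂μ, DifferentiableOn ℂ (F · a) s)
    (h_bound : ∀ᵐ a ∂μ, ∀ z ∈ s, ‖F z a‖ ≤ bound a) (bound_integrable : Integrable bound μ) :
    DifferentiableAt ℂ (fun z ↦ ∫ a, F z a ∂μ) z₀ := by
  obtain ⟨r, hr, hrs⟩ := Metric.nhds_basis_closedBall.mem_iff.1 hs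
  have hball {z : ℂ} (hz : z ∈ Metric.ball z₀ (r / 2)) : Metric.closedBall z (r / 2) ⊆ s :=
    (Metric.closedBall_subset_closedBall' (by linarith [Metric.mem_ball.1 hz])).trans hrs
  have hderiv : ∀ᵐ a ∂μ, ∀ z ∈ Metric.ball z₀ (r / 2), HasDerivAt (F · a) (deriv (F · a) z) z := by
    filter_upwards [h_diff] with a ha z hz
    refine (ha.differentiableAt ?_).hasDerivAt
    exact mem_of_superset (Metric.closedBall_mem_nhds z (half_pos hr)) (hball hz)
  have hF_int : Integrable (F z₀) μ := by
    refine bound_integrable.mono' hF_meas.self_of_nhds ?_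
    filter_upwards [h_bound] with a ha using ha z₀ (mem_of_mem_nhds hs)
  have hderiv_meas : AEStronglyMeasurable (fun a ↦ deriv (F · a) z₀) μ :=
    aestronglyMeasurable_deriv_of_eventually hF_meas <| by
      filter_upwards [h_diff] with a ha using ha.differentiableAt hs
  have hcauchy : ∀ᵐ a ∂μ, ∀ z ∈ Metric.ball z₀ (r / 2),
      ‖deriv (F · a) z‖ ≤ bound a / (r / 2) := by
    filter_upwards [h_diff, h_bound] with a ha hb z hz
    exact norm_deriv_le_of_forall_mem_sphere_norm_le (half_pos hr)
      (ha.diffContOnCl_ball (hball hz))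
      fun w hw ↦ hb w (hball hz (Metric.sphere_subset_closedBall hw))
  exact (hasDerivAt_integral_of_dominated_loc_of_deriv_le (Metric.ball_mem_nhds z₀ (half_pos hr))
    hF_meas hF_int hderiv_meas hcauchy (bound_integrable.div_const _) hderiv).2.differentiableAt

end HolomorphicIntegral

/-! ### Mellin transforms -/

section Mellin

variable {E : Type*} [NormedAddCommGroup E] [NormedSpace ℂ E] {s : ℂ} {m : E}

theorem hasMellin_congr {f g : ℝ → E} (hfg : EqOn f g (Ioi 0)) :
    HasMellin f s m ↔ HasMellin g s m := by
  have heq : EqOn (fun t : ℝ ↦ (t : ℂ) ^ (s - 1) • f t) (fun t : ℝ ↦ (t : ℂ) ^ (s - 1) • g t)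
      (Ioi 0) := fun t ht ↦ by simp only [hfg ht]
  simp only [HasMellin, MellinConvergent, mellin, integrableOn_congr_fun heq measurableSet_Ioi,
    setIntegral_congr_fun measurableSet_Ioi heq]

theorem hasMellin_ofReal_smul_iff {f : ℝ → E} :
    HasMellin (fun t : ℝ ↦ (t : ℂ) • f t) s m ↔ HasMellin f (s + 1) m := by
  simp only [HasMellin, ← mellin_cpow_smul, ← MellinConvergent.cpow_smul, cpow_one]

theorem hasMellin_integral {α : Type*} [MeasurableSpace α] {μ : Measure α} [SFinite μ]
    {f : α → ℝ → E}
    (hf : Integrable (fun p : α × ℝ ↦ (p.2 : ℂ) ^ (s - 1) • f p.1 p.2)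
      (μ.prod (volume.restrict (Ioi 0)))) :
    HasMellin (fun t ↦ ∫ x, f x t ∂μ) s (∫ x, mellin (f x) s ∂μ) := by
  simp only [HasMellin, MellinConvergent, mellin, ← integral_smul]
  exact ⟨hf.integral_prod_right, (integral_integral_swap hf).symm⟩

end Mellin

theorem hasMellin_one_ofReal_iff {f : ℝ → ℝ} {m : ℝ} :
    HasMellin (fun u ↦ (f u : ℂ)) 1 m ↔
      IntegrableOn f (Ioi 0) ∧ ∫ u in Ioi (0 : ℝ), f u = m := by
  simp only [HasMellin, MellinConvergent, mellin, sub_self, cpow_zero, one_smul, IntegrableOn]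
  exact and_congr ⟨fun h ↦ by simpa using h.re, Integrable.ofReal⟩
    (by rw [integral_complex_ofReal, ofReal_inj])

section MellinExp

variable {a r : ℂ}

theorem integrableOn_rpow_mul_exp_neg_mul {p b : ℝ} (hp : 0 < p) (hb : 0 < b) :
    IntegrableOn (fun t : ℝ ↦ t ^ (p - 1) * Real.exp (-(b * t))) (Ioi 0) := by
  simpa using integrableOn_rpow_mul_exp_neg_mul_rpow (s := p - 1) (p := 1) (b := b)
    (by linarith) one_pos hb

theorem norm_ofReal_cpow_smul_exp_neg_mul {t : ℝ} (ht : 0 < t) :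
    ‖(t : ℂ) ^ (a - 1) • cexp (-(r * t))‖ = t ^ (a.re - 1) * Real.exp (-(r.re * t)) := by
  simp [norm_cpow_eq_rpow_re_of_pos ht, norm_exp]

theorem mellinConvergent_exp_neg_mul (ha : 0 < a.re) (hr : 0 < r.re) :
    MellinConvergent (fun t : ℝ ↦ cexp (-(r * t))) a := by
  refine (integrableOn_rpow_mul_exp_neg_mul ha hr).mono'
    (Measurable.aestronglyMeasurable (by fun_prop)) ?_
  filter_upwards [ae_restrict_mem measurableSet_Ioi] with t ht
  rw [norm_ofReal_cpow_smul_exp_neg_mul ht]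

theorem differentiableAt_mellin_exp_neg_mul (ha : 0 < a.re) (hr : 0 < r.re) :
    DifferentiableAt ℂ (fun r : ℂ ↦ mellin (fun t : ℝ ↦ cexp (-(r * t))) a) r := by
  have hs : {z : ℂ | r.re / 2 < z.re} ∈ 𝓝 r :=
    (isOpen_lt continuous_const continuous_re).mem_nhds (half_lt_self hr)
  refine differentiableAt_integral_of_dominated hs
    (.of_forall fun z ↦ Measurable.aestronglyMeasurable (by fun_prop))
    (.of_forall fun t ↦ by fun_prop) ?_ (integrableOn_rpow_mul_exp_neg_mul ha (half_pos hr))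
  filter_upwards [ae_restrict_mem measurableSet_Ioi] with t (ht : 0 < t) z (hz : r.re / 2 < z.re)
  rw [norm_ofReal_cpow_smul_exp_neg_mul ht]
  gcongr

theorem hasMellin_exp_neg_mul (ha : 0 < a.re) (hr : 0 < r.re) :
    HasMellin (fun t : ℝ ↦ cexp (-(r * t))) a (r ^ (-a) * Gamma a) := by
  refine ⟨mellinConvergent_exp_neg_mul ha hr, ?_⟩
  -- Both sides are holomorphic in `r`; on the positive reals this is Euler's integral.
  have hopen : IsOpen {z : ℂ | 0 < z.re} := isOpen_lt continuous_const continuous_re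
  have hleft : AnalyticOnNhd ℂ (fun r : ℂ ↦ mellin (fun t : ℝ ↦ cexp (-(r * t))) a)
      {z : ℂ | 0 < z.re} :=
    DifferentiableOn.analyticOnNhd
      (fun _ hz ↦ (differentiableAt_mellin_exp_neg_mul ha hz).differentiableWithinAt) hopen
  have hright : AnalyticOnNhd ℂ (fun r : ℂ ↦ r ^ (-a) * Gamma a) {z : ℂ | 0 < z.re} :=
    DifferentiableOn.analyticOnNhd (fun _ hz ↦ DifferentiableAt.differentiableWithinAt <|
      (differentiableAt_id.cpow_const (Or.inl hz)).mul_const _) hopen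
  have hreal : ∀ x : ℝ, 0 < x →
      mellin (fun t : ℝ ↦ cexp (-(x * t))) a = (x : ℂ) ^ (-a) * Gamma a := fun x hx ↦ by
    simp only [mellin, smul_eq_mul]
    rw [Complex.integral_cpow_mul_exp_neg_mul_Ioi ha hx, one_div, inv_cpow, cpow_neg]
    rw [arg_ofReal_of_nonneg hx.le]
    exact Real.pi_pos.ne
  have htendsto : Tendsto ((↑) : ℝ → ℂ) (𝓝[≠] 1) (𝓝[≠] 1) := by
    simpa using (hasDerivAt_id (1 : ℝ)).ofReal_comp.tendsto_nhdsNE (by simp)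
  exact hleft.eqOn_of_preconnected_of_frequently_eq hright
    (convex_halfSpace_re_gt 0).isPreconnected (z₀ := 1) (by simp)
    (htendsto.frequently ((eventually_nhdsWithin_of_eventually_nhds
      ((lt_mem_nhds one_pos).mono hreal)).frequently)) hr

theorem hasMellin_exp_neg_mul_mul_one_sub_cos {z : ℂ} (ha : 0 < a.re) (hr : |z.im| < r.re) :
    HasMellin (fun t : ℝ ↦ cexp (-(r * t)) * (1 - Complex.cos (z * t))) a
      (Gamma a * (r ^ (-a) - ((r + z * I) ^ (-a) + (r - z * I) ^ (-a)) / 2)) := by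
  have hr' := abs_lt.1 hr
  obtain ⟨h₀, e₀⟩ := hasMellin_exp_neg_mul ha ((abs_nonneg _).trans_lt hr)
  obtain ⟨h₁, e₁⟩ := hasMellin_exp_neg_mul (r := r + z * I) ha (by simp; linarith)
  obtain ⟨h₂, e₂⟩ := hasMellin_exp_neg_mul (r := r - z * I) ha (by simp; linarith)
  obtain ⟨h₃, e₃⟩ := hasMellin_add h₁ h₂
  convert! hasMellin_sub h₀ (h₃.div_const 2) using 1
  · ext t
    simp only [Complex.cos, add_mul, neg_add, sub_eq_add_neg, exp_add]
    ring_nf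
  · rw [mellin_div_const, e₀, e₃, e₁, e₂]
    ring

end MellinExp

/-! ### Convergence and holomorphy of `φ` -/

theorem norm_one_sub_exp_le (z : ℂ) : ‖1 - cexp z‖ ≤ ‖z‖ * Real.exp ‖z‖ := by
  simpa [norm_sub_rev] using norm_exp_sub_sum_le_norm_mul_exp z 1

theorem norm_one_sub_cos_le (z : ℂ) : ‖1 - Complex.cos z‖ ≤ ‖z‖ ^ 2 * Real.exp ‖z‖ := by
  have hexp (w : ℂ) : ‖cexp w - (1 + w)‖ ≤ ‖w‖ ^ 2 * Real.exp ‖w‖ := by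
    simpa [Finset.sum_range_succ] using norm_exp_sub_sum_le_norm_mul_exp w 2
  have hpos := hexp (z * I)
  have hneg := hexp (-z * I)
  have hcos : 1 - Complex.cos z =
      -((cexp (z * I) - (1 + z * I)) + (cexp (-z * I) - (1 + -z * I))) / 2 := by
    rw [Complex.cos]; ring
  simp only [norm_mul, norm_neg, norm_I, mul_one] at hpos hneg
  rw [hcos, norm_div, norm_neg, RCLike.norm_ofNat, div_le_iff₀ two_pos]
  linarith [norm_add_le (cexp (z * I) - (1 + z * I)) (cexp (-z * I) - (1 + -z * I))]

theorem norm_one_sub_exp_mul_cos_le (z w : ℂ) :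
    ‖1 - cexp z * Complex.cos w‖ ≤ (‖z‖ + ‖w‖ ^ 2 * Real.exp ‖w‖) * Real.exp ‖z‖ :=
  calc ‖1 - cexp z * Complex.cos w‖ = ‖(1 - cexp z) + cexp z * (1 - Complex.cos w)‖ := by ring_nf
    _ ≤ ‖1 - cexp z‖ + ‖cexp z‖ * ‖1 - Complex.cos w‖ := by
      rw [← norm_mul]; exact norm_add_le _ _
    _ ≤ ‖z‖ * Real.exp ‖z‖ + Real.exp ‖z‖ * (‖w‖ ^ 2 * Real.exp ‖w‖) := by
      gcongr
      exacts [norm_one_sub_exp_le z, norm_exp_le_exp_norm z, norm_one_sub_cos_le w]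
    _ = _ := by ring

theorem arctan_le_self {x : ℝ} (hx : 0 ≤ x) : Real.arctan x ≤ x := by
  simpa using Real.le_tan (Real.arctan_nonneg.2 hx) (Real.arctan_lt_pi_div_two x)

theorem one_add_sq_cpow_eq_exp (k : ℂ) (u : ℝ) :
    ((1 + u ^ 2 : ℝ) : ℂ) ^ (k / 2) = cexp (k * (Real.log (1 + u ^ 2) / 2 : ℝ)) := by
  have hpos : (0 : ℝ) < 1 + u ^ 2 := by positivity
  rw [cpow_def_of_ne_zero (ofReal_ne_zero.2 hpos.ne'), ← ofReal_log hpos.le]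
  push_cast
  ring_nf

theorem norm_one_sub_cpow_mul_cos_arctan_le {k : ℂ} {N : ℕ} (hk : ‖k‖ ≤ N) {u : ℝ} (hu : 0 ≤ u) :
    ‖1 - ((1 + u ^ 2 : ℝ) : ℂ) ^ (k / 2) * Complex.cos (k * (Real.arctan u : ℂ))‖ ≤
      (N + N ^ 2 * Real.exp (N * 2)) * (u ^ 2 * (1 + u ^ 2) ^ N) := by
  have hpos : (0 : ℝ) < 1 + u ^ 2 := by positivity
  have hlog_nonneg : 0 ≤ Real.log (1 + u ^ 2) := Real.log_nonneg (by simp [sq_nonneg])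
  have hlog_le : Real.log (1 + u ^ 2) / 2 ≤ u ^ 2 := by
    linarith [Real.log_le_sub_one_of_pos hpos]
  have hlog : ‖k * (Real.log (1 + u ^ 2) / 2 : ℝ)‖ ≤ N * (Real.log (1 + u ^ 2) / 2) := by
    rw [norm_mul, norm_real, Real.norm_of_nonneg (by positivity)]; gcongr
  have hexp : Real.exp (N * (Real.log (1 + u ^ 2) / 2)) ≤ (1 + u ^ 2) ^ N := by
    rw [← Real.exp_log (pow_pos hpos N), Real.log_pow]
    gcongr
    linarith
  have harctan_le_two : Real.arctan u ≤ 2 := by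
    linarith [Real.arctan_lt_pi_div_two u, Real.pi_lt_four]
  have harctan : ‖k * (Real.arctan u : ℂ)‖ ≤ N * Real.arctan u := by
    rw [norm_mul, norm_real, Real.norm_of_nonneg (Real.arctan_nonneg.2 hu)]; gcongr
  rw [one_add_sq_cpow_eq_exp]
  calc _ ≤ _ := norm_one_sub_exp_mul_cos_le _ _
    _ ≤ (N * (Real.log (1 + u ^ 2) / 2) +
          (N * Real.arctan u) ^ 2 * Real.exp (N * Real.arctan u)) *
        Real.exp (N * (Real.log (1 + u ^ 2) / 2)) := by gcongr
    _ ≤ (N * u ^ 2 + (N * u) ^ 2 * Real.exp (N * 2)) * (1 + u ^ 2) ^ N := by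
      have := Real.arctan_nonneg.2 hu
      gcongr
      exact arctan_le_self hu
    _ = _ := by ring

theorem mul_inv_sinh_le {x : ℝ} (hx : 0 ≤ x) : x * (Real.sinh x)⁻¹ ≤ 2 * Real.exp (-(x / 2)) := by
  have hsinh : x / 2 ≤ Real.sinh (x / 2) := Real.self_le_sinh_iff.2 (by positivity)
  have hcosh : Real.exp (x / 2) / 2 ≤ Real.cosh (x / 2) := by
    rw [Real.cosh_eq]; linarith [Real.exp_pos (-(x / 2))]
  refine mul_inv_le_of_le_mul₀ (Real.sinh_nonneg_iff.2 hx) (by positivity) ?_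
  calc x = 2 * Real.exp (-(x / 2)) * (2 * (x / 2) * (Real.exp (x / 2) / 2)) := by
        rw [Real.exp_neg]; field_simp
    _ ≤ 2 * Real.exp (-(x / 2)) * (2 * Real.sinh (x / 2) * Real.cosh (x / 2)) := by gcongr
    _ = 2 * Real.exp (-(x / 2)) * Real.sinh x := by rw [← Real.sinh_two_mul]; ring_nf

theorem inv_sinh_sq_mul_sq_le {u : ℝ} (hu : 0 ≤ u) :
    (Real.sinh (Real.pi * u / 2))⁻¹ ^ 2 * u ^ 2 ≤ 4 * Real.exp (-(3 / 2 * u)) := by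
  have hu_le : 3 / 2 * u ≤ Real.pi * u / 2 := by nlinarith [Real.pi_gt_three]
  have hx : 0 ≤ Real.pi * u / 2 := by positivity
  have hinv : 0 ≤ (Real.sinh (Real.pi * u / 2))⁻¹ := inv_nonneg.2 (Real.sinh_nonneg_iff.2 hx)
  calc (Real.sinh (Real.pi * u / 2))⁻¹ ^ 2 * u ^ 2
      = (u * (Real.sinh (Real.pi * u / 2))⁻¹) ^ 2 := by ring
    _ ≤ (Real.pi * u / 2 * (Real.sinh (Real.pi * u / 2))⁻¹) ^ 2 :=
      pow_le_pow_left₀ (mul_nonneg hu hinv)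
        (mul_le_mul_of_nonneg_right (by linarith) hinv) 2
    _ ≤ (2 * Real.exp (-(Real.pi * u / 2 / 2))) ^ 2 :=
      pow_le_pow_left₀ (mul_nonneg hx hinv) (mul_inv_sinh_le hx) 2
    _ = 4 * Real.exp (-(Real.pi * u / 2)) := by
      rw [mul_pow, ← Real.exp_nat_mul]; push_cast; ring_nf
    _ ≤ 4 * Real.exp (-(3 / 2 * u)) := by gcongr

theorem one_add_sq_pow_le {u : ℝ} (hu : 0 ≤ u) (N : ℕ) :
    (1 + u ^ 2) ^ N ≤ 4 ^ N * (2 * N).factorial * Real.exp ((1 + u) / 2) := by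
  have hexp := Real.pow_div_factorial_le_exp (x := (1 + u) / 2) (by positivity) (2 * N)
  rw [div_le_iff₀ (by positivity)] at hexp
  calc (1 + u ^ 2) ^ N ≤ ((1 + u) ^ 2) ^ N := by gcongr; nlinarith
    _ = 4 ^ N * ((1 + u) / 2) ^ (2 * N) := by rw [pow_mul, ← mul_pow]; ring
    _ ≤ 4 ^ N * (Real.exp ((1 + u) / 2) * (2 * N).factorial) := by gcongr
    _ = _ := by ring

theorem exists_norm_varphiIntegrand_le (N : ℕ) : ∃ C : ℝ, ∀ k : ℂ, ‖k‖ ≤ N → ∀ u : ℝ, 0 ≤ u →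
    ‖varphiIntegrand k u‖ ≤ C * Real.exp (-u) := by
  have hc : (0 : ℝ) ≤ N + N ^ 2 * Real.exp (N * 2) := by positivity
  set c : ℝ := N + N ^ 2 * Real.exp (N * 2)
  refine ⟨c * (4 * (4 ^ N * (2 * N).factorial * Real.exp (1 / 2))), fun k hk u hu ↦ ?_⟩
  have hexp : Real.exp (-(3 / 2 * u)) * Real.exp ((1 + u) / 2) =
      Real.exp (1 / 2) * Real.exp (-u) := by
    rw [← Real.exp_add, ← Real.exp_add]; ring_nf
  rw [varphiIntegrand, norm_mul, norm_real, Real.norm_of_nonneg (by positivity)]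
  calc _ ≤ (Real.sinh (Real.pi * u / 2))⁻¹ ^ 2 * (c * (u ^ 2 * (1 + u ^ 2) ^ N)) := by
        gcongr
        exact norm_one_sub_cpow_mul_cos_arctan_le hk hu
    _ = c * ((Real.sinh (Real.pi * u / 2))⁻¹ ^ 2 * u ^ 2 * (1 + u ^ 2) ^ N) := by ring
    _ ≤ c * (4 * Real.exp (-(3 / 2 * u)) *
        (4 ^ N * (2 * N).factorial * Real.exp ((1 + u) / 2))) :=
      mul_le_mul_of_nonneg_left (mul_le_mul (inv_sinh_sq_mul_sq_le hu) (one_add_sq_pow_le hu N)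
        (by positivity) (by positivity)) hc
    _ = _ := by linear_combination c * (4 * (4 ^ N * (2 * N).factorial)) * hexp

theorem measurable_varphiIntegrand (k : ℂ) : Measurable (varphiIntegrand k) := by
  have := Real.continuous_arctan.measurable
  unfold varphiIntegrand
  fun_prop

theorem integrableOn_varphiIntegrand (k : ℂ) : IntegrableOn (varphiIntegrand k) (Ioi 0) := by
  obtain ⟨N, hN⟩ := exists_nat_ge ‖k‖
  obtain ⟨C, hC⟩ := exists_norm_varphiIntegrand_le N
  refine ((integrableOn_exp_neg_Ioi 0).const_mul C).mono'
    (measurable_varphiIntegrand k).aestronglyMeasurable ?_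
  filter_upwards [ae_restrict_mem measurableSet_Ioi] with u hu using hC k hN u (le_of_lt hu)

theorem differentiable_varphiIntegrand (u : ℝ) : Differentiable ℂ (varphiIntegrand · u) := by
  simp only [varphiIntegrand, one_add_sq_cpow_eq_exp]
  fun_prop

theorem differentiable_varphi : Differentiable ℂ varphi := by
  intro k
  obtain ⟨N, hN⟩ := exists_nat_gt ‖k‖
  obtain ⟨C, hC⟩ := exists_norm_varphiIntegrand_le N
  have hball : Metric.ball 0 (N : ℝ) ∈ 𝓝 k := Metric.isOpen_ball.mem_nhds (by simpa using hN)
  have hbound : ∀ᵐ u ∂volume.restrict (Ioi (0 : ℝ)), ∀ z ∈ Metric.ball 0 (N : ℝ),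
      ‖varphiIntegrand z u‖ ≤ C * Real.exp (-u) := by
    filter_upwards [ae_restrict_mem measurableSet_Ioi] with u (hu : 0 < u) z hz
    exact hC z (mem_ball_zero_iff.1 hz).le u hu.le
  have hintegral := differentiableAt_integral_of_dominated hball
    (.of_forall fun z ↦ (measurable_varphiIntegrand z).aestronglyMeasurable)
    (.of_forall fun u ↦ (differentiable_varphiIntegrand u).differentiableOn) hbound
    ((integrableOn_exp_neg_Ioi 0).const_mul C)
  unfold varphi
  fun_prop

/-! ### Series expansions of hyperbolic functions -/

theorem inv_sinh_eq (x : ℝ) :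
    (Real.sinh x)⁻¹ = 2 * Real.exp (-x) * (1 - Real.exp (-(2 * x)))⁻¹ := by
  have hsinh : Real.sinh x = Real.exp x * (1 - Real.exp (-(2 * x))) / 2 := by
    rw [Real.sinh_eq, mul_sub, ← Real.exp_add]; ring_nf
  rw [hsinh, inv_div, div_eq_mul_inv, mul_inv, ← Real.exp_neg, mul_assoc]

theorem hasSum_inv_sinh {x : ℝ} (hx : 0 < x) :
    HasSum (fun n : ℕ ↦ 2 * Real.exp (-((2 * n + 1) * x))) (Real.sinh x)⁻¹ := by
  have hlt : Real.exp (-(2 * x)) < 1 := Real.exp_lt_one_iff.2 (by linarith)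
  rw [inv_sinh_eq]
  convert! (hasSum_geometric_of_lt_one (Real.exp_pos _).le hlt).mul_left (2 * Real.exp (-x))
    using 2 with n
  rw [← Real.exp_nat_mul, mul_assoc, ← Real.exp_add]
  ring_nf

theorem hasSum_inv_sinh_sq {x : ℝ} (hx : 0 < x) :
    HasSum (fun n : ℕ ↦ 4 * (n + 1) * Real.exp (-((n + 1) * (2 * x)))) ((Real.sinh x)⁻¹ ^ 2) := by
  have hlt : ‖Real.exp (-(2 * x))‖ < 1 := by
    rw [Real.norm_of_nonneg (Real.exp_pos _).le]
    exact Real.exp_lt_one_iff.2 (by linarith)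
  have hgeom := (hasSum_choose_mul_geometric_of_norm_lt_one 1 hlt).mul_left
    (4 * Real.exp (-(2 * x)))
  have hsq : Real.exp (-x) ^ 2 = Real.exp (-(2 * x)) := by
    rw [← Real.exp_nat_mul]; push_cast; ring_nf
  convert! hgeom using 1
  · ext n
    rw [← Real.exp_nat_mul, Nat.choose_one_right, add_one_mul (n : ℝ) (2 * x), neg_add,
      Real.exp_add]
    push_cast
    ring_nf
  · rw [inv_sinh_eq, mul_pow, mul_pow, hsq, one_div, inv_pow]
    norm_num

theorem hasSum_pi_mul_cot_sub_one {z : ℂ} (hz : z ∈ integerComplement) :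
    HasSum (fun n : ℕ ↦ 2 * z ^ 2 / (z ^ 2 - (n + 1) ^ 2))
      (Real.pi * z * cot (Real.pi * z) - 1) := by
  have hz0 : z ≠ 0 := by
    rintro rfl
    exact hz ⟨0, by simp⟩
  have hsum := (summable_cotTerm hz).hasSum.mul_left z
  rw [← cot_series_rep' hz] at hsum
  convert! hsum using 1
  · ext n
    rw [cotTerm_identity hz, sq_sub_sq]
    ring
  · field_simp

theorem hasSum_mul_coth_sub_one {t : ℝ} (ht : t ≠ 0) :
    HasSum (fun n : ℕ ↦ 2 * t ^ 2 / (((n + 1) * Real.pi) ^ 2 + t ^ 2))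
      (t * (Real.cosh t / Real.sinh t) - 1) := by
  have hpi : (Real.pi : ℂ) ≠ 0 := ofReal_ne_zero.2 Real.pi_ne_zero
  have hmem : (t * I / Real.pi : ℂ) ∈ integerComplement := by
    rintro ⟨m, hm⟩
    rw [eq_div_iff hpi] at hm
    exact ht (by simpa using (congrArg im hm).symm)
  have hsum := hasSum_pi_mul_cot_sub_one hmem
  rw [mul_div_cancel₀ _ hpi, cot, Complex.cos_mul_I, Complex.sin_mul_I] at hsum
  rw [← Complex.hasSum_ofReal]
  convert! hsum using 1
  · ext n
    have hz_sq : (t * I / Real.pi : ℂ) ^ 2 = -(t ^ 2 / Real.pi ^ 2) := by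
      rw [div_pow, mul_pow, I_sq]; ring
    have hden : (-(t ^ 2 / Real.pi ^ 2) - (n + 1) ^ 2 : ℂ) =
        -((((n + 1) * Real.pi) ^ 2 + t ^ 2 : ℝ) : ℂ) / Real.pi ^ 2 := by
      push_cast
      field_simp
      ring
    rw [hz_sq, hden, ofReal_div, div_div_eq_mul_div, div_neg]
    push_cast
    field_simp
  · push_cast
    field_simp

/-! ### The Mellin transform of `t / sinh t` -/

theorem hasMellin_exp_neg_mul_mul_one_sub_cos_one {b : ℝ} (hb : 0 < b) (t : ℝ) :
    HasMellin (fun u : ℝ ↦ ((Real.exp (-(b * u)) * (1 - Real.cos (u * t)) : ℝ) : ℂ)) 1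
      (t ^ 2 / (b * (b ^ 2 + t ^ 2)) : ℝ) := by
  convert! hasMellin_exp_neg_mul_mul_one_sub_cos (a := 1) (r := b) (z := t) (by simp) (by simpa)
    using 1
  · ext u
    push_cast
    ring_nf
  · have hb0 : (b : ℂ) ≠ 0 := ofReal_ne_zero.2 hb.ne'
    have hprod : (b + t * I) * (b - t * I) = b ^ 2 + t ^ 2 := by
      linear_combination -(t : ℂ) ^ 2 * I_sq
    have hne : ((b : ℂ) + t * I) * (b - t * I) ≠ 0 := by
      rw [hprod]
      exact_mod_cast (by positivity : b ^ 2 + t ^ 2 ≠ 0)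
    have hplus := left_ne_zero_of_mul hne
    have hminus := right_ne_zero_of_mul hne
    simp only [cpow_neg_one, Gamma_one, one_mul]
    push_cast
    rw [← hprod]
    field_simp
    linear_combination -2 * hprod

theorem integral_inv_sinh_sq_mul_one_sub_cos {t : ℝ} (ht : t ≠ 0) :
    ∫ u in Ioi (0 : ℝ), (Real.sinh (Real.pi * u / 2))⁻¹ ^ 2 * (1 - Real.cos (u * t)) =
      2 / Real.pi * (t * (Real.cosh t / Real.sinh t) - 1) := by
  let F (n : ℕ) (u : ℝ) : ℝ :=
    4 * (n + 1) * (Real.exp (-((n + 1) * Real.pi * u)) * (1 - Real.cos (u * t)))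
  have hlaplace (n : ℕ) := hasMellin_one_ofReal_iff.1 <|
    hasMellin_exp_neg_mul_mul_one_sub_cos_one (b := (n + 1) * Real.pi) (by positivity) t
  have hF_int (n : ℕ) : IntegrableOn (F n) (Ioi 0) := (hlaplace n).1.const_mul _
  have hF_nonneg (n : ℕ) (u : ℝ) : 0 ≤ F n u := by
    have : 0 ≤ 1 - Real.cos (u * t) := sub_nonneg.2 (Real.cos_le_one _)
    positivity
  have hF_eq (n : ℕ) : ∫ u in Ioi (0 : ℝ), F n u =
      2 / Real.pi * (2 * t ^ 2 / (((n + 1) * Real.pi) ^ 2 + t ^ 2)) := by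
    rw [integral_const_mul, (hlaplace n).2]
    field_simp
    norm_num
  have hF_sum {u : ℝ} (hu : 0 < u) :
      ∑' n, F n u = (Real.sinh (Real.pi * u / 2))⁻¹ ^ 2 * (1 - Real.cos (u * t)) := by
    rw [← ((hasSum_inv_sinh_sq (by positivity : 0 < Real.pi * u / 2)).mul_right _).tsum_eq]
    refine tsum_congr fun n ↦ ?_
    simp only [F, show 2 * (Real.pi * u / 2) = Real.pi * u by ring, mul_assoc]
  have hcoth := (hasSum_mul_coth_sub_one ht).mul_left (2 / Real.pi)
  have hsum := hasSum_integral_of_summable_integral_norm hF_int (by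
    simpa only [Real.norm_of_nonneg (hF_nonneg _ _), hF_eq] using hcoth.summable)
  simp only [hF_eq] at hsum
  rw [← hsum.unique hcoth]
  exact setIntegral_congr_fun measurableSet_Ioi fun u hu ↦ (hF_sum hu).symm

theorem log_one_add_mul_I (u : ℝ) :
    Complex.log (1 + u * I) = (Real.log (1 + u ^ 2) / 2 : ℝ) + (Real.arctan u : ℝ) * I := by
  have hnorm : ‖(1 + u * I : ℂ)‖ = √(1 + u ^ 2) := by
    simpa using norm_add_mul_I 1 u
  have harg : (1 + u * I : ℂ).arg = Real.arctan u := by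
    rw [arg_of_re_nonneg (by simp), hnorm, Real.arctan_eq_arcsin]; simp
  rw [Complex.log, hnorm, harg, Real.log_sqrt (by positivity)]

theorem one_add_mul_I_cpow (k : ℂ) (u : ℝ) :
    (1 + u * I) ^ k =
      ((1 + u ^ 2 : ℝ) : ℂ) ^ (k / 2) * cexp (k * (Real.arctan u : ℂ) * I) := by
  have hne : (1 + u * I : ℂ) ≠ 0 := fun h ↦ by simpa using congrArg re h
  rw [one_add_sq_cpow_eq_exp, cpow_def_of_ne_zero hne, log_one_add_mul_I, ← exp_add]
  ring_nf

theorem one_add_mul_I_cpow_add_one_sub_mul_I_cpow (k : ℂ) (u : ℝ) :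
    (1 + u * I) ^ k + (1 - u * I) ^ k =
      2 * (((1 + u ^ 2 : ℝ) : ℂ) ^ (k / 2) * Complex.cos (k * (Real.arctan u : ℂ))) := by
  have hminus := one_add_mul_I_cpow k (-u)
  rw [ofReal_neg, neg_mul, ← sub_eq_add_neg, neg_sq, Real.arctan_neg] at hminus
  rw [one_add_mul_I_cpow, hminus, Complex.cos]
  push_cast
  ring_nf

theorem hasMellin_exp_neg_mul_one_sub_cos {a : ℂ} (ha : 0 < a.re) (u : ℝ) :
    HasMellin (fun t : ℝ ↦ cexp (-t) * (1 - Complex.cos (u * t))) a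
      (Gamma a *
        (1 - ((1 + u ^ 2 : ℝ) : ℂ) ^ (-a / 2) * Complex.cos (-a * (Real.arctan u : ℂ)))) := by
  have h := hasMellin_exp_neg_mul_mul_one_sub_cos (r := 1) (z := u) ha (by simp)
  rw [one_add_mul_I_cpow_add_one_sub_mul_I_cpow, one_cpow, mul_div_cancel_left₀ _ two_ne_zero] at h
  simpa only [one_mul] using h

/-- The kernel `csch²(π u / 2) e^{-t} (1 - cos (u t))`, which links `varphi` to `t / sinh t`: its
Mellin transform in `t` is `varphiIntegrand` up to a Gamma factor, and its integral over `u > 0` is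
elementary. -/
noncomputable def varphiKernel (u t : ℝ) : ℝ :=
  (Real.sinh (Real.pi * u / 2))⁻¹ ^ 2 * (Real.exp (-t) * (1 - Real.cos (u * t)))

theorem integral_varphiKernel {t : ℝ} (ht : t ≠ 0) :
    ∫ u in Ioi (0 : ℝ), varphiKernel u t =
      2 / Real.pi * (Real.exp (-t) * (t * (Real.cosh t / Real.sinh t) - 1)) := by
  simp only [varphiKernel, mul_left_comm _ (Real.exp (-t)), integral_const_mul,
    integral_inv_sinh_sq_mul_one_sub_cos ht]

theorem mellin_varphiKernel {a : ℂ} (ha : 0 < a.re) (u : ℝ) :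
    mellin (fun t ↦ (varphiKernel u t : ℂ)) a = Gamma a * varphiIntegrand (-a) u := by
  have h := mellin_const_smul (fun t : ℝ ↦ cexp (-t) * (1 - Complex.cos (u * t))) a
    (((Real.sinh (Real.pi * u / 2))⁻¹ ^ 2 : ℝ) : ℂ)
  rw [(hasMellin_exp_neg_mul_one_sub_cos ha u).2, smul_eq_mul, mul_left_comm] at h
  simpa [varphiKernel, varphiIntegrand] using h

theorem norm_varphiKernel_le (u t : ℝ) :
    ‖varphiKernel u t‖ ≤
      (Real.sinh (Real.pi * u / 2))⁻¹ ^ 2 * u ^ 2 * (t ^ 2 * Real.exp (-t)) := by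
  have hcos : 0 ≤ 1 - Real.cos (u * t) := sub_nonneg.2 (Real.cos_le_one _)
  have hcos_le : 1 - Real.cos (u * t) ≤ (u * t) ^ 2 := by
    linarith [Real.one_sub_sq_div_two_le_cos (x := u * t), sq_nonneg (u * t)]
  rw [varphiKernel, Real.norm_of_nonneg (by positivity)]
  calc _ ≤ (Real.sinh (Real.pi * u / 2))⁻¹ ^ 2 * (Real.exp (-t) * (u * t) ^ 2) := by gcongr
    _ = _ := by ring

theorem integrableOn_inv_sinh_sq_mul_sq :
    IntegrableOn (fun u : ℝ ↦ (Real.sinh (Real.pi * u / 2))⁻¹ ^ 2 * u ^ 2) (Ioi 0) := by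
  have hexp : IntegrableOn (fun u : ℝ ↦ Real.exp (-(3 / 2 * u))) (Ioi 0) := by
    simpa using exp_neg_integrableOn_Ioi 0 (b := 3 / 2) (by norm_num)
  refine (hexp.const_mul 4).mono' (by fun_prop) ?_
  filter_upwards [ae_restrict_mem measurableSet_Ioi] with u (hu : 0 < u)
  rw [Real.norm_of_nonneg (by positivity)]
  exact inv_sinh_sq_mul_sq_le hu.le

theorem integrable_cpow_smul_varphiKernel {a : ℂ} (ha : -2 < a.re) :
    Integrable (fun p : ℝ × ℝ ↦ (p.2 : ℂ) ^ (a - 1) • (varphiKernel p.1 p.2 : ℂ))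
      ((volume.restrict (Ioi 0)).prod (volume.restrict (Ioi 0))) := by
  have hgamma : IntegrableOn (fun t : ℝ ↦ t ^ (a.re + 2 - 1) * Real.exp (-t)) (Ioi 0) := by
    simpa using integrableOn_rpow_mul_exp_neg_mul (p := a.re + 2) (by linarith) one_pos
  refine (integrableOn_inv_sinh_sq_mul_sq.mul_prod hgamma).mono' ?_ ?_
  · unfold varphiKernel
    exact Measurable.aestronglyMeasurable (by fun_prop)
  · rw [Measure.prod_restrict]
    filter_upwards [ae_restrict_mem (measurableSet_Ioi.prod measurableSet_Ioi)]
      with ⟨u, t⟩ ⟨_, (ht : 0 < t)⟩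
    have hpow : t ^ (a.re + 2 - 1) = t ^ (a.re - 1) * t ^ 2 := by
      rw [← Real.rpow_natCast, ← Real.rpow_add ht]; push_cast; ring_nf
    rw [norm_smul, norm_cpow_eq_rpow_re_of_pos ht, norm_real, sub_re, one_re, hpow]
    calc _ ≤ t ^ (a.re - 1) * ((Real.sinh (Real.pi * u / 2))⁻¹ ^ 2 * u ^ 2 *
          (t ^ 2 * Real.exp (-t))) := by gcongr; exact norm_varphiKernel_le u t
      _ = _ := by ring

theorem hasMellin_exp_neg_mul_mul_coth_sub_one {a : ℂ} (ha : 0 < a.re) :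
    HasMellin
      (fun t : ℝ ↦ ((Real.exp (-t) * (t * (Real.cosh t / Real.sinh t) - 1) : ℝ) : ℂ)) a
      (Gamma a * (Real.pi / 2 * ∫ u in Ioi (0 : ℝ), varphiIntegrand (-a) u)) := by
  have hswap := hasMellin_integral (f := fun u t ↦ (varphiKernel u t : ℂ))
    (integrable_cpow_smul_varphiKernel (a := a) (by linarith))
  simp only [mellin_varphiKernel ha, integral_const_mul] at hswap
  have hscaled := hasMellin_const_smul hswap.1 (Real.pi / 2 : ℂ)
  rw [hswap.2, smul_eq_mul, mul_left_comm] at hscaled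
  refine (hasMellin_congr fun t (ht : 0 < t) ↦ ?_).1 hscaled
  rw [integral_complex_ofReal, integral_varphiKernel ht.ne', smul_eq_mul]
  push_cast
  have hpi : (Real.pi : ℂ) ≠ 0 := ofReal_ne_zero.2 Real.pi_ne_zero
  field_simp

theorem exp_neg_mul_mul_coth_sub_one_add {t : ℝ} (ht : t ≠ 0) :
    Real.exp (-t) * (t * (Real.cosh t / Real.sinh t) - 1) + Real.exp (-t) + t * Real.exp (-t) =
      t / Real.sinh t := by
  have hsinh : Real.sinh t ≠ 0 := Real.sinh_ne_zero.2 ht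
  have hexp : Real.exp (-t) * (Real.cosh t + Real.sinh t) = 1 := by
    rw [Real.cosh_add_sinh, ← Real.exp_add, neg_add_cancel, Real.exp_zero]
  field_simp
  linear_combination t * hexp

theorem hasMellin_div_sinh {a : ℂ} (ha : 0 < a.re) :
    HasMellin (fun t : ℝ ↦ ((t / Real.sinh t : ℝ) : ℂ)) a (Gamma a * varphi (-a)) := by
  have ha0 : a ≠ 0 := fun h ↦ by simp [h] at ha
  have hcoth := hasMellin_exp_neg_mul_mul_coth_sub_one ha
  have hexp := hasMellin_exp_neg_mul ha (r := 1) (by simp)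
  have hmul_exp := hasMellin_ofReal_smul_iff.2
    (hasMellin_exp_neg_mul (a := a + 1) (r := 1) (by simp; linarith) (by simp))
  have hcoth_exp := hasMellin_add hcoth.1 hexp.1
  have hsum := hasMellin_add hcoth_exp.1 hmul_exp.1
  rw [hcoth_exp.2, hcoth.2, hexp.2, hmul_exp.2, one_cpow, one_cpow, Gamma_add_one a ha0] at hsum
  convert (hasMellin_congr fun t (ht : 0 < t) ↦ ?_).1 hsum using 1
  · rw [varphi]; ring
  · rw [← exp_neg_mul_mul_coth_sub_one_add ht.ne']
    push_cast
    simp only [one_mul, smul_eq_mul]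

/-! ### `φ` in terms of `ζ` -/

theorem hasSum_one_div_odd_cpow {s : ℂ} (hs : 1 < s.re) :
    HasSum (fun n : ℕ ↦ 1 / ((2 * n + 1 : ℕ) : ℂ) ^ s) ((1 - (2 : ℂ) ^ (-s)) * riemannZeta s) := by
  have hsummable : Summable fun n : ℕ ↦ 1 / (n : ℂ) ^ s := summable_one_div_nat_cpow.2 hs
  have hall : HasSum (fun n : ℕ ↦ 1 / (n : ℂ) ^ s) (riemannZeta s) := by
    rw [zeta_eq_tsum_one_div_nat_cpow hs]
    exact hsummable.hasSum
  have heven : HasSum (fun n : ℕ ↦ 1 / ((2 * n : ℕ) : ℂ) ^ s) ((2 : ℂ) ^ (-s) * riemannZeta s) := by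
    convert! hall.mul_left ((2 : ℂ) ^ (-s)) using 2 with n
    rw [Nat.cast_mul, natCast_mul_natCast_cpow, cpow_neg, Nat.cast_ofNat]
    ring
  have hodd : Summable fun n : ℕ ↦ 1 / ((2 * n + 1 : ℕ) : ℂ) ^ s :=
    hsummable.comp_injective (i := fun n ↦ 2 * n + 1) fun m n h ↦ by simpa using h
  have hsplit := (heven.even_add_odd (f := fun n : ℕ ↦ 1 / (n : ℂ) ^ s) hodd.hasSum).unique hall
  convert! hodd.hasSum using 1
  linear_combination -hsplit

theorem mellin_inv_sinh {s : ℂ} (hs : 1 < s.re) :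
    mellin (fun t : ℝ ↦ (((Real.sinh t)⁻¹ : ℝ) : ℂ)) s =
      2 * Gamma s * ((1 - (2 : ℂ) ^ (-s)) * riemannZeta s) := by
  have hodd := hasSum_one_div_odd_cpow hs
  refine (hasSum_mellin (a := fun _ : ℕ ↦ (2 : ℂ)) (p := fun n ↦ ((2 * n + 1 : ℕ) : ℝ))
    (fun n ↦ Or.inr (by positivity)) (by linarith) (fun t ht ↦ ?_) ?_).unique ?_
  · convert! Complex.hasSum_ofReal.2 (hasSum_inv_sinh ht) using 2 with n
    push_cast
    ring_nf
  · refine (hodd.summable.norm.mul_left 2).congr fun n ↦ ?_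
    rw [norm_div, norm_natCast_cpow_of_pos (by positivity)]
    simp [div_eq_mul_inv]
  · convert! hodd.mul_left (2 * Gamma s) using 2 with n
    rw [ofReal_natCast]
    ring

theorem varphi_neg {a : ℂ} (ha : 0 < a.re) :
    varphi (-a) = 2 * a * (1 - (2 : ℂ) ^ (-(a + 1))) * riemannZeta (a + 1) := by
  have ha0 : a ≠ 0 := fun h ↦ by simp [h] at ha
  have hdiv_sinh : HasMellin (fun t : ℝ ↦ (t : ℂ) • (((Real.sinh t)⁻¹ : ℝ) : ℂ)) a
      (Gamma a * varphi (-a)) := by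
    simpa only [div_eq_mul_inv, ofReal_mul, smul_eq_mul] using hasMellin_div_sinh ha
  have heq := (hasMellin_ofReal_smul_iff.1 hdiv_sinh).2
  rw [mellin_inv_sinh (by simpa using ha), Gamma_add_one a ha0] at heq
  refine mul_left_cancel₀ (Gamma_ne_zero_of_re_pos ha) ?_
  linear_combination -heq

theorem varphi_one_sub {k : ℂ} (hk : k ≠ 1) :
    2 * (k - 1) * (1 - (2 : ℂ) ^ (-k)) * riemannZeta k = varphi (1 - k) := by
  have hopen : IsOpen ({1}ᶜ : Set ℂ) := isOpen_compl_singleton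
  have hleft : AnalyticOnNhd ℂ (fun k ↦ 2 * (k - 1) * (1 - (2 : ℂ) ^ (-k)) * riemannZeta k)
      {1}ᶜ := by
    refine DifferentiableOn.analyticOnNhd (fun z hz ↦ ?_) hopen
    have hcpow : DifferentiableAt ℂ (fun k : ℂ ↦ (2 : ℂ) ^ (-k)) z :=
      differentiableAt_id.neg.const_cpow (Or.inl two_ne_zero)
    have hfactor : DifferentiableAt ℂ (fun k : ℂ ↦ 2 * (k - 1)) z := by fun_prop
    exact ((hfactor.mul (hcpow.const_sub 1)).mul
      (differentiableAt_riemannZeta hz)).differentiableWithinAt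
  have hright : AnalyticOnNhd ℂ (fun k ↦ varphi (1 - k)) {1}ᶜ :=
    (differentiable_varphi.comp (differentiable_id.const_sub 1)).differentiableOn.analyticOnNhd
      hopen
  refine hleft.eqOn_of_preconnected_of_eventuallyEq hright
    (isConnected_compl_singleton_of_one_lt_rank (by simp) 1).isPreconnected
    (z₀ := 2) (by simp) ?_ hk
  have hhalfPlane : {z : ℂ | 1 < z.re} ∈ 𝓝 (2 : ℂ) :=
    (isOpen_lt continuous_const continuous_re).mem_nhds (by simp)
  filter_upwards [hhalfPlane] with z (hz : 1 < z.re)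
  simpa using (varphi_neg (a := z - 1) (by simpa using hz)).symm

theorem varphi_eq {k : ℂ} (hk : k ≠ 0) :
    varphi k = -(2 * k) * (1 - (2 : ℂ) ^ (k - 1)) * riemannZeta (1 - k) := by
  have h := varphi_one_sub (k := 1 - k) (by simpa using hk)
  rw [sub_sub_cancel, neg_sub] at h
  rw [← h]
  ring

theorem varphi_zero : varphi 0 = 1 := by
  simp [varphi, varphiIntegrand]

theorem varphi_eq_Gamma_mul {k : ℂ} (hk : k ≠ 1) (hk_neg : ∀ n : ℕ, k ≠ -((n : ℂ) + 1)) :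
    -2 * Gamma (k + 1) * ((2 : ℂ) ^ (1 - k) - 1) * (Real.pi : ℂ) ^ (-k) *
      Complex.cos ((Real.pi : ℂ) * k / 2) * riemannZeta k = varphi k := by
  rcases eq_or_ne k 0 with rfl | hk0
  · rw [varphi_zero, riemannZeta_zero]
    norm_num
  have hk_nat : ∀ n : ℕ, k ≠ -n := by
    rintro (_ | n)
    · simpa using hk0
    · simpa using hk_neg n
  have hinv : (2 : ℂ) ^ (1 - k) * 2 ^ (k - 1) = 1 := by
    rw [← cpow_add _ _ two_ne_zero]; simp
  have htwo : (2 : ℂ) ^ (1 - k) = 2 * 2 ^ (-k) := by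
    rw [sub_eq_add_neg, cpow_add _ _ two_ne_zero, cpow_one]
  have hsplit : (2 * (Real.pi : ℂ)) ^ (-k) = 2 ^ (-k) * (Real.pi : ℂ) ^ (-k) := by
    simpa using mul_cpow_ofReal_nonneg (a := 2) zero_le_two Real.pi_pos.le (-k)
  rw [varphi_eq hk0, riemannZeta_one_sub hk_nat hk, hsplit, Gamma_add_one k hk0]
  rw [htwo] at hinv ⊢
  linear_combination (-2 * k * Gamma k * (Real.pi : ℂ) ^ (-k) *
    Complex.cos ((Real.pi : ℂ) * k / 2) * riemannZeta k) * hinv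

/-! ### Zeros -/

theorem cpow_eq_one_iff_exists_int {x s : ℂ} (hx : Complex.log x ≠ 0) :
    x ^ s = 1 ↔ ∃ n : ℤ, s = 2 * Real.pi * I * n / Complex.log x := by
  have hx0 : x ≠ 0 := fun h ↦ hx (by rw [h, log_zero])
  simp only [cpow_def_of_ne_zero hx0, exp_eq_one_iff, eq_div_iff hx, mul_comm s,
    mul_comm (2 * _ * I)]

theorem one_sub_two_cpow_sub_one_eq_zero_iff {k : ℂ} :
    1 - (2 : ℂ) ^ (k - 1) = 0 ↔
      ∃ j : ℤ, k = 1 + 2 * (Real.pi : ℂ) * I * (j : ℂ) / ((Real.log 2 : ℝ) : ℂ) := by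
  have hlog : Complex.log 2 = (Real.log 2 : ℝ) := (natCast_log (n := 2)).symm
  have hlog_ne : Complex.log 2 ≠ 0 := by
    rw [hlog]
    exact ofReal_ne_zero.2 (Real.log_pos one_lt_two).ne'
  rw [sub_eq_zero, eq_comm, cpow_eq_one_iff_exists_int hlog_ne, hlog]
  simp only [sub_eq_iff_eq_add']

theorem completedRiemannZeta_eq_zero_iff {k : ℂ} (hk : 0 < k.re) :
    completedRiemannZeta k = 0 ↔ riemannZeta k = 0 := by
  have hk0 : k ≠ 0 := fun h ↦ by simp [h] at hk
  rw [riemannZeta_def_of_ne_zero hk0, div_eq_zero_iff, or_iff_left (Gammaℝ_ne_zero_of_re_pos hk)]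

theorem riemannZeta_one_sub_eq_zero_iff {k : ℂ} (h0 : 0 < k.re) (h1 : k.re < 1) :
    riemannZeta (1 - k) = 0 ↔ riemannZeta k = 0 := by
  rw [← completedRiemannZeta_eq_zero_iff (by simpa using h1), completedRiemannZeta_one_sub,
    completedRiemannZeta_eq_zero_iff h0]

theorem riemannZeta_eq_zero_iff_of_re_nonpos {k : ℂ} (hk : k.re ≤ 0) :
    riemannZeta k = 0 ↔ ∃ n : ℕ, k = -2 * ((n : ℂ) + 1) := by
  refine ⟨fun h ↦ ?_, fun ⟨n, hn⟩ ↦ hn ▸ riemannZeta_neg_two_mul_nat_add_one n⟩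
  have hk0 : k ≠ 0 := by
    rintro rfl
    norm_num [riemannZeta_zero] at h
  have hre : 1 ≤ (1 - k).re := by simpa using hk
  have hcompleted : completedRiemannZeta k ≠ 0 := by
    rw [← completedRiemannZeta_one_sub, Ne, completedRiemannZeta_eq_zero_iff (by linarith)]
    exact riemannZeta_ne_zero_of_one_le_re hre
  rw [riemannZeta_def_of_ne_zero hk0, div_eq_zero_iff, or_iff_right hcompleted,
    Gammaℝ_eq_zero_iff] at h
  obtain ⟨_ | n, rfl⟩ := h
  · simp at hk0
  · exact ⟨n, by push_cast; ring⟩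

theorem isNontrivialZetaZero_iff {k : ℂ} :
    IsNontrivialZetaZero k ↔ riemannZeta k = 0 ∧ 0 < k.re ∧ k.re < 1 := by
  constructor
  · rintro ⟨-, hzero, htrivial⟩
    refine ⟨hzero, ?_, ?_⟩
    · contrapose! htrivial
      exact (riemannZeta_eq_zero_iff_of_re_nonpos htrivial).1 hzero
    · contrapose! hzero
      exact riemannZeta_ne_zero_of_one_le_re hzero
  · rintro ⟨hzero, h0, h1⟩
    refine ⟨fun h ↦ by simp [h] at h1, hzero, ?_⟩
    rintro ⟨n, rfl⟩
    simp at h0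
    linarith [n.cast_nonneg (α := ℝ)]

theorem riemannHypothesis_iff_forall_isNontrivialZetaZero :
    RiemannHypothesis ↔ ∀ k : ℂ, IsNontrivialZetaZero k → k.re = 1 / 2 :=
  ⟨fun h k ⟨hk1, hzero, hn⟩ ↦ h k hzero hn hk1, fun h k hzero hn hk1 ↦ h k ⟨hk1, hzero, hn⟩⟩

theorem IsTrivialVarphiPoint.one_le_re {k : ℂ} (hk : IsTrivialVarphiPoint k) : 1 ≤ k.re := by
  rcases hk with ⟨n, rfl⟩ | ⟨j, rfl⟩
  · simp
  · rw [← ofReal_intCast, add_re, div_ofReal_re]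
    simp

theorem IsTrivialVarphiPoint.varphi_eq_zero {k : ℂ} (hk : IsTrivialVarphiPoint k) :
    varphi k = 0 := by
  have hk0 : k ≠ 0 := fun h ↦ absurd hk.one_le_re (by simp [h])
  rw [varphi_eq hk0]
  rcases hk with ⟨_ | n, rfl⟩ | h
  · simp
  · rw [show 1 - (2 * ((n + 1 : ℕ) : ℂ) + 1) = -2 * ((n : ℂ) + 1) by push_cast; ring,
      riemannZeta_neg_two_mul_nat_add_one, mul_zero]
  · rw [one_sub_two_cpow_sub_one_eq_zero_iff.2 h, mul_zero, zero_mul]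

theorem varphi_eq_zero_iff {k : ℂ} (hk : ¬ IsTrivialVarphiPoint k) :
    varphi k = 0 ↔ k ≠ 0 ∧ riemannZeta (1 - k) = 0 := by
  have htwo : 1 - (2 : ℂ) ^ (k - 1) ≠ 0 :=
    fun h ↦ hk (Or.inr (one_sub_two_cpow_sub_one_eq_zero_iff.1 h))
  rcases eq_or_ne k 0 with rfl | hk0
  · simp [varphi_zero]
  · simp [varphi_eq hk0, hk0, htwo]

theorem varphi_eq_zero_iff_riemannZeta_eq_zero {k : ℂ} (h0 : 0 < k.re) (h1 : k.re < 1) :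
    varphi k = 0 ↔ riemannZeta k = 0 := by
  have hk0 : k ≠ 0 := fun h ↦ by simp [h] at h0
  rw [varphi_eq_zero_iff fun h ↦ h1.not_ge h.one_le_re, riemannZeta_one_sub_eq_zero_iff h0 h1,
    and_iff_right hk0]

theorem isNontrivialVarphiZero_iff {k : ℂ} :
    IsNontrivialVarphiZero k ↔ varphi k = 0 ∧ 0 < k.re ∧ k.re < 1 := by
  refine ⟨fun ⟨hzero, hk⟩ ↦ ⟨hzero, ?_⟩,
    fun ⟨hzero, _, h1⟩ ↦ ⟨hzero, fun h ↦ h1.not_ge h.one_le_re⟩⟩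
  obtain ⟨hk0, hzeta⟩ := (varphi_eq_zero_iff hk).1 hzero
  have hnontrivial : IsNontrivialZetaZero (1 - k) := by
    refine ⟨by simpa using hk0, hzeta, fun ⟨n, hn⟩ ↦ hk (Or.inl ⟨n + 1, ?_⟩)⟩
    push_cast
    linear_combination -hn
  simpa [and_comm] using (isNontrivialZetaZero_iff.1 hnontrivial).2

theorem isNontrivialZetaZero_iff_isNontrivialVarphiZero {k : ℂ} :
    IsNontrivialZetaZero k ↔ IsNontrivialVarphiZero k := by
  rw [isNontrivialZetaZero_iff, isNontrivialVarphiZero_iff]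
  exact and_congr_left fun ⟨h0, h1⟩ ↦ (varphi_eq_zero_iff_riemannZeta_eq_zero h0 h1).symm

theorem riemannHypothesis_iff_forall_varphi :
    RiemannHypothesis ↔ ∀ k : ℂ, varphi k = 0 → 0 < k.re → k.re < 1 → k.re = 1 / 2 := by
  simp only [riemannHypothesis_iff_forall_isNontrivialZetaZero,
    isNontrivialZetaZero_iff_isNontrivialVarphiZero, isNontrivialVarphiZero_iff, and_imp]

theorem mainTheorem1 :
    -- the integral defining `φ` converges absolutely for every complex `k`, and `φ` is entire
    (∀ k : ℂ, MeasureTheory.IntegrableOn (varphiIntegrand k) (Set.Ioi (0 : ℝ))) ∧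
    Differentiable ℂ varphi ∧
    -- the first identity, with `k! = Γ(k + 1)`, away from the negative integers and `1`
    (∀ k : ℂ, k ≠ 1 → (∀ n : ℕ, k ≠ -((n : ℂ) + 1)) →
      -2 * Complex.Gamma (k + 1) * ((2 : ℂ) ^ (1 - k) - 1) * (Real.pi : ℂ) ^ (-k) *
        Complex.cos ((Real.pi : ℂ) * k / 2) * riemannZeta k = varphi k) ∧
    -- the second identity, away from the pole of zeta
    (∀ k : ℂ, k ≠ 1 →
      2 * (k - 1) * (1 - (2 : ℂ) ^ (-k)) * riemannZeta k = varphi (1 - k)) ∧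
    -- the trivial zeros of `φ` are zeros of `φ`
    (∀ k : ℂ, IsTrivialVarphiPoint k → varphi k = 0) ∧
    -- the non-trivial zeros of zeta and of `φ` coincide
    (∀ k : ℂ, IsNontrivialZetaZero k ↔ IsNontrivialVarphiZero k) ∧
    -- the non-trivial zeros of `φ` are its zeros in the open critical strip
    (∀ k : ℂ, IsNontrivialVarphiZero k ↔ varphi k = 0 ∧ 0 < k.re ∧ k.re < 1) ∧
    -- the Riemann hypothesis in terms of `φ`
    (RiemannHypothesis ↔ ∀ k : ℂ, varphi k = 0 → 0 < k.re → k.re < 1 → k.re = 1 / 2) :=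
  ⟨integrableOn_varphiIntegrand, differentiable_varphi, fun _ ↦ varphi_eq_Gamma_mul,
    fun _ ↦ varphi_one_sub, fun _ ↦ IsTrivialVarphiPoint.varphi_eq_zero,
    fun _ ↦ isNontrivialZetaZero_iff_isNontrivialVarphiZero, fun _ ↦ isNontrivialVarphiZero_iff,
    riemannHypothesis_iff_forall_varphi⟩
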